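/- Let $M$ be a complex manifold of dimension $n$ (Hausdorff, modelled on $\mathbb{C}^n$ with its Euclidean norm $\|\cdot\|$). Plurisubharmonic functions are upper semicontinuous with values in $[-\infty,\infty)$, and $\equiv-\infty$ is allowed; a function $u$ is strictly plurisubharmonic if every point of $M$ has a coordinate neighborhood with coordinates $z$ on which $u-\varepsilon\|z\|^2$ is plurisubharmonic for some $\varepsilon>0$. A function $u$ on $M$ has a logarithmic pole at $w\in M$ if $u(z)-\log\|z-w\|$ is bounded above on some coordinate neighborhood of $w$, the norm being taken in the coordinates (in particular $u(w)=-\infty$). The pluricomplex Green function of $M$ is \[g_M(z,w)=\sup u(z),\qquad z,w\in M,\] where the supremum is over all negative plurisubharmonic functions $u$ on $M$ with a logarithmic pole at $w$. Theorem. If there is a bounded continuous strictly plurisubharmonic function $u:M\to\mathbb{R}$, then $M$ is locally uniformly pluri-Greenian, i.e. every point $w_0\in M$ has a coordinate neighborhood $U$ for which there are an open set $W\subset U$ containing $w_0$ and a constant $c\in\mathbb{R}$ such that \[g_M(z,w)>\log\|z-w\|+c\qquad\text{for all } w\in W \text{ and all } z\in U\setminus\{w\},\] where $\|z-w\|$ is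 computed in the coordinates of $U$. -/

import Mathlib

open scoped Manifold ContDiff

/-- The mean value of an extended-real function over the circle of centre `a` and radius `r`:
the mean of the positive part minus the mean of the negative part. For functions that are bounded
above on the circle (such as upper semicontinuous functions with values in `[-∞, ∞)`)
the first term is finite, so no indeterminate difference occurs. -/
noncomputable def circleMean (v : ℂ → EReal) (a : ℂ) (r : ℝ) : EReal :=
  (MeasureTheory.laverage (MeasureTheory.volume.restrict (Set.Ioc (0 : ℝ) (2 * Real.pi)))
    (fun θ => (v (circleMap a r θ)).toENNReal) : EReal) -
  (MeasureTheory.laverage (MeasureTheory.volume.restrict (Set.Ioc (0 : ℝ) (2 * Real.pi)))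
    (fun θ => (-v (circleMap a r θ)).toENNReal) : EReal)

/-- Subharmonic functions on an open set `V ⊆ ℂ`: upper semicontinuous functions with values in
`[-∞, ∞)` that satisfy the local submean inequality. The constant `-∞` is allowed. -/
structure IsSubharmonicOn (v : ℂ → EReal) (V : Set ℂ) : Prop where
  usc : UpperSemicontinuousOn v V
  lt_top : ∀ a ∈ V, v a < ⊤
  submean : ∀ a ∈ V, ∃ ρ : ℝ, 0 < ρ ∧ ∀ r : ℝ, 0 < r → r < ρ → v a ≤ circleMean v a r

section Manifold

variable (n : ℕ) {M : Type*} [TopologicalSpace M] [ChartedSpace (EuclideanSpace ℂ (Fin n)) M]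

/-- The holomorphic coordinate charts of `M`: all charts of the maximal holomorphic atlas. The
coordinate neighbourhood belonging to `φ` is `φ.source`. -/
abbrev holoCharts (M : Type*) [TopologicalSpace M] [ChartedSpace (EuclideanSpace ℂ (Fin n)) M] :
    Set (OpenPartialHomeomorph M (EuclideanSpace ℂ (Fin n))) :=
  IsManifold.maximalAtlas 𝓘(ℂ, EuclideanSpace ℂ (Fin n)) ω M

/-- Plurisubharmonic functions on an open subset `S` of a complex manifold: upper semicontinuous
functions with values in `[-∞, ∞)` whose composition with every holomorphic map from an open
subset of `ℂ` into `S` is subharmonic. The constant `-∞` is allowed. -/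
structure IsPlurisubharmonicOn (u : M → EReal) (S : Set M) : Prop where
  usc : UpperSemicontinuousOn u S
  lt_top : ∀ z ∈ S, u z < ⊤
  comp_disc : ∀ (V : Set ℂ) (f : ℂ → M), IsOpen V →
    MDifferentiableOn 𝓘(ℂ, ℂ) 𝓘(ℂ, EuclideanSpace ℂ (Fin n)) f V → Set.MapsTo f V S →
    IsSubharmonicOn (fun ζ => u (f ζ)) V

/-- Strictly plurisubharmonic functions: near each point, in suitable holomorphic coordinates,
`u - ε ‖z‖²` is plurisubharmonic for some `ε > 0`. -/
def IsStrictlyPlurisubharmonic (u : M → EReal) : Prop :=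
  ∀ w : M, ∃ φ ∈ holoCharts n M, w ∈ φ.source ∧ ∃ ε : ℝ, 0 < ε ∧
    IsPlurisubharmonicOn n (fun z => u z - ((ε * ‖φ z‖ ^ 2 : ℝ) : EReal)) φ.source

variable {n} in
/-- `log ‖z - w‖` in the coordinates `φ`, with value `-∞` at `z = w`. -/
noncomputable def logDist (φ : OpenPartialHomeomorph M (EuclideanSpace ℂ (Fin n))) (z w : M) :
    EReal :=
  ENNReal.log ‖φ z - φ w‖ₑ

/-- `u` has a logarithmic pole at `w`: on some coordinate neighbourhood of `w`, the difference
`u(z) - log ‖z - w‖` is bounded above. -/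
def HasLogPole (u : M → EReal) (w : M) : Prop :=
  ∃ φ ∈ holoCharts n M, w ∈ φ.source ∧ ∃ C : ℝ,
    ∀ z ∈ φ.source, u z ≤ logDist φ z w + (C : EReal)

/-- The pluricomplex Green function `g_M(z, w)`: the supremum of `u z` over all negative
plurisubharmonic functions `u` on `M` with a logarithmic pole at `w`. -/
noncomputable def pluricomplexGreen (z w : M) : EReal :=
  ⨆ u ∈ {u : M → EReal | IsPlurisubharmonicOn n u Set.univ ∧ (∀ x, u x < 0) ∧ HasLogPole n u w},
    u z

/-- `M` is locally uniformly pluri-Greenian. At `z = w` both sides of the estimate are `-∞`, so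
the strict inequality is required for `z ≠ w`. -/
def IsLocallyUniformlyPluriGreenian (M : Type*) [TopologicalSpace M]
    [ChartedSpace (EuclideanSpace ℂ (Fin n)) M] : Prop :=
  ∀ w₀ : M, ∃ φ ∈ holoCharts n M, w₀ ∈ φ.source ∧
    ∃ W : Set M, IsOpen W ∧ w₀ ∈ W ∧ W ⊆ φ.source ∧ ∃ c : ℝ,
      ∀ w ∈ W, ∀ z ∈ φ.source, z ≠ w → logDist φ z w + (c : EReal) < pluricomplexGreen n z w

end Manifold

open Filter Topology Metric Set Real InnerProductSpace

/-! Bounding $g_M(\cdot,w)$ from below requires only one competitor for each $w$ near $w_0$, with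
bounds independent of $w$. In a chart with $p=\varphi(w_0)$, the function $\log\|z-w\|$ has the
right pole but is only local. Strictness of $u$ pays for a cutoff:
$Ku+K\varepsilon(6R^2-\|z-p\|^2)+\log\|z-w\|$ is still plurisubharmonic off $w$. For $K$ large and
$\|w-p\|<R/2$, the part added to $Ku$ is nonnegative on $R\le\|z-p\|\le 2R$ and nonpositive where
$\|z-p\|\ge 3R$ within the shell, so a maximum glues the sum to $Ku$ on the rest of $M$
(`pshAt_add_gluedPoleTerm`). Since $u$ is bounded, subtracting a constant independent of $w$ makes
the result negative.

Off the pole the competitor is real and continuous, so ordinary circle averages suffice; at the pole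
the submean inequality is trivial (`isPlurisubharmonicOn_of_pshAt`). -/

theorem circleMean_congr {v w : ℂ → EReal} {a : ℂ} {r : ℝ} (h : EqOn v w (sphere a |r|)) :
    circleMean v a r = circleMean w a r := by
  have (θ : ℝ) : v (circleMap a r θ) = w (circleMap a r θ) := h (circleMap_mem_sphere' a r θ)
  simp only [circleMean, this]

/-- For a real function that is continuous on the circle, `circleMean` is the usual average. -/
theorem circleMean_coe {g : ℂ → ℝ} {a : ℂ} {r : ℝ} (hg : ContinuousOn g (sphere a |r|)) :
    circleMean (fun z => (g z : EReal)) a r = ((circleAverage g a r : ℝ) : EReal) := by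
  have hint : MeasureTheory.IntegrableOn (fun θ => g (circleMap a r θ)) (Ioc 0 (2 * π)) := by
    have := hg.circleIntegrable'
    exact (intervalIntegrable_iff_integrableOn_Ioc_of_le two_pi_pos.le).1 this
  have key := MeasureTheory.integral_eq_lintegral_pos_part_sub_lintegral_neg_part hint
  have h1 := hint.lintegral_lt_top
  have h2 := (MeasureTheory.Integrable.neg hint).lintegral_lt_top
  simp only [Pi.neg_apply] at h2
  have hpi : (MeasureTheory.volume.restrict (Ioc (0 : ℝ) (2 * π))) univ
      = ENNReal.ofReal (2 * π) := by simp
  have hdiv (x : ENNReal) (hx : x ≠ ⊤) :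
      ((x / ENNReal.ofReal (2 * π) : ENNReal) : EReal) = ((x.toReal / (2 * π) : ℝ) : EReal) := by
    have hx' : x / ENNReal.ofReal (2 * π) ≠ ⊤ :=
      ENNReal.div_ne_top hx (by simp [pi_pos])
    rw [← ENNReal.ofReal_toReal hx', ENNReal.toReal_div, ENNReal.toReal_ofReal two_pi_pos.le,
      EReal.coe_ennreal_ofReal, max_eq_left (by positivity)]
  have hneg (θ : ℝ) : -((g (circleMap a r θ) : ℝ) : EReal) = ((-g (circleMap a r θ) : ℝ) : EReal) :=
    rfl
  simp only [circleMean, MeasureTheory.laverage_eq, hpi, hneg, EReal.real_coe_toENNReal]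
  rw [hdiv _ h1.ne, hdiv _ h2.ne, circleAverage, intervalIntegral.integral_of_le two_pi_pos.le, key,
    ← EReal.coe_sub, smul_eq_mul]
  congr 1
  ring

/-! ### Submean inequalities on small circles in the plane -/

theorem eventually_sphere_of_eventually_nhds {P : ℂ → Prop} {a : ℂ} (h : ∀ᶠ z in 𝓝 a, P z) :
    ∀ᶠ r in 𝓝[>] (0 : ℝ), ∀ z ∈ sphere a |r|, P z := by
  obtain ⟨ρ, hρ, hP⟩ := Metric.eventually_nhds_iff.1 h
  filter_upwards [Ioo_mem_nhdsGT hρ] with r hr z hz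
  refine hP ?_
  rw [mem_sphere.1 hz, abs_of_pos hr.1]
  exact hr.2

/-- `g` is continuous near `a` and satisfies the submean inequality on all small circles
around `a`. -/
def SubmeanAt (g : ℂ → ℝ) (a : ℂ) : Prop :=
  (∀ᶠ z in 𝓝 a, ContinuousAt g z) ∧ ∀ᶠ r in 𝓝[>] (0 : ℝ), g a ≤ circleAverage g a r

theorem eventually_continuousOn_sphere {g : ℂ → ℝ} {a : ℂ} (h : ∀ᶠ z in 𝓝 a, ContinuousAt g z) :
    ∀ᶠ r in 𝓝[>] (0 : ℝ), ContinuousOn g (sphere a |r|) := by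
  filter_upwards [eventually_sphere_of_eventually_nhds h] with r hr z hz
  exact (hr z hz).continuousWithinAt

namespace SubmeanAt

variable {g g' : ℂ → ℝ} {a : ℂ}

/-- Support principle: a minorant touching at the centre passes on its submean inequality. Maxima,
squared norms and $\log\|F\|$ are all handled this way. -/
theorem mono (h : SubmeanAt g a) (hle : ∀ᶠ z in 𝓝 a, g z ≤ g' z) (ha : g a = g' a)
    (hc : ∀ᶠ z in 𝓝 a, ContinuousAt g' z) : SubmeanAt g' a := by
  refine ⟨hc, ?_⟩
  filter_upwards [h.2, eventually_continuousOn_sphere h.1, eventually_continuousOn_sphere hc,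
    eventually_sphere_of_eventually_nhds hle] with r hr h1 h2 h3
  rw [← ha]
  exact hr.trans (circleAverage_mono h1.circleIntegrable' h2.circleIntegrable' h3)

theorem congr (h : SubmeanAt g a) (he : g =ᶠ[𝓝 a] g') : SubmeanAt g' a :=
  h.mono (he.mono fun _ hz => hz.le) he.eq_of_nhds <| by
    filter_upwards [h.1, he.eventuallyEq_nhds] with z hz hz'
    exact hz.congr hz'

theorem add (h : SubmeanAt g a) (h' : SubmeanAt g' a) : SubmeanAt (fun z => g z + g' z) a := by
  refine ⟨by filter_upwards [h.1, h'.1] with z h1 h2 using h1.add h2, ?_⟩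
  filter_upwards [h.2, h'.2, eventually_continuousOn_sphere h.1,
    eventually_continuousOn_sphere h'.1] with r hr hr' h1 h2
  exact (add_le_add hr hr').trans
    (circleAverage_add h1.circleIntegrable' h2.circleIntegrable').ge

theorem const_mul (h : SubmeanAt g a) {c : ℝ} (hc : 0 ≤ c) : SubmeanAt (fun z => c * g z) a := by
  refine ⟨by filter_upwards [h.1] with z h1 using h1.const_mul c, ?_⟩
  filter_upwards [h.2] with r hr
  have : circleAverage (fun z => c * g z) a r = c * circleAverage g a r :=
    circleAverage_fun_smul (a := c) (f := g)
  rw [this]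
  exact mul_le_mul_of_nonneg_left hr hc

theorem sup (h : SubmeanAt g a) (h' : SubmeanAt g' a) :
    SubmeanAt (fun z => max (g z) (g' z)) a := by
  have hc : ∀ᶠ z in 𝓝 a, ContinuousAt (fun z => max (g z) (g' z)) z := by
    filter_upwards [h.1, h'.1] with z h1 h2 using h1.max h2
  rcases le_total (g a) (g' a) with hle | hle
  · exact h'.mono (Eventually.of_forall fun z => le_max_right _ _) (max_eq_right hle).symm hc
  · exact h.mono (Eventually.of_forall fun z => le_max_left _ _) (max_eq_left hle).symm hc

theorem of_harmonicAt (h : HarmonicAt g a) : SubmeanAt g a := by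
  refine ⟨h.eventually.mono fun z hz => hz.1.continuousAt, ?_⟩
  obtain ⟨ρ, hρ, hP⟩ := Metric.eventually_nhds_iff.1 h.eventually
  filter_upwards [Ioo_mem_nhdsGT hρ] with r hr
  refine (InnerProductSpace.HarmonicOnNhd.circleAverage_eq fun z hz => hP ?_).ge
  rw [mem_closedBall, abs_of_pos hr.1] at hz
  exact hz.trans_lt hr.2

theorem const (c : ℝ) : SubmeanAt (fun _ => c) a :=
  ⟨Eventually.of_forall fun _ => continuousAt_const,
    Eventually.of_forall fun r => (circleAverage_const c a r).ge⟩

variable {E : Type*} [NormedAddCommGroup E] [InnerProductSpace ℂ E] {F : ℂ → E}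

theorem analyticAt_inner (hF : ∀ᶠ ζ in 𝓝 a, DifferentiableAt ℂ F ζ) (c : E) :
    AnalyticAt ℂ (fun ζ => inner ℂ c (F ζ)) a := by
  rw [Complex.analyticAt_iff_eventually_differentiableAt]
  filter_upwards [hF] with ζ hζ
  exact (innerSL ℂ c).differentiableAt.comp ζ hζ

theorem re_inner (hF : ∀ᶠ ζ in 𝓝 a, DifferentiableAt ℂ F ζ) (c : E) :
    SubmeanAt (fun ζ => (inner ℂ c (F ζ)).re) a :=
  of_harmonicAt (analyticAt_inner hF c).harmonicAt_re

/-- Expanding $\|F-F(a)\|^2\ge 0$ gives the harmonic minorant $2\,\mathrm{Re}\langle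
F(a),F\rangle-\|F(a)\|^2$, which touches at $a$. -/
theorem norm_sq (hF : ∀ᶠ ζ in 𝓝 a, DifferentiableAt ℂ F ζ) :
    SubmeanAt (fun ζ => ‖F ζ‖ ^ 2) a := by
  have key (x y : E) : 2 * (inner ℂ x y).re + -‖x‖ ^ 2 ≤ ‖y‖ ^ 2 := by
    have := norm_sub_sq (𝕜 := ℂ) y x
    have h2 : RCLike.re (inner ℂ y x) = (inner ℂ x y).re  :=
      inner_re_symm _ _
    rw [h2] at this
    nlinarith [sq_nonneg ‖y - x‖]
  refine mono (((re_inner hF (F a)).const_mul zero_le_two).add (const (-‖F a‖ ^ 2)))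
    (Eventually.of_forall fun ζ => key _ _) ?_ ?_
  · have : (inner ℂ (F a) (F a)).re = ‖F a‖ ^ 2 := by
      rw [inner_self_eq_norm_sq_to_K]; norm_cast
    rw [this]; ring
  · filter_upwards [hF] with ζ hζ using hζ.continuousAt.norm.pow 2

/-- By Cauchy–Schwarz, $\log|\langle F(a),F\rangle|-\log\|F(a)\|$ is a minorant touching at $a$. It
is harmonic there because the inner product is holomorphic and nonzero at $a$. -/
theorem log_norm (hF : ∀ᶠ ζ in 𝓝 a, DifferentiableAt ℂ F ζ) (ha : F a ≠ 0) :
    SubmeanAt (fun ζ => log ‖F ζ‖) a := by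
  have hna : 0 < ‖F a‖ := norm_pos_iff.2 ha
  have hself : inner ℂ (F a) (F a) ≠ 0 := inner_self_ne_zero.2 ha
  have han := analyticAt_inner hF (F a)
  have h0 : ∀ᶠ ζ in 𝓝 a, inner ℂ (F a) (F ζ) ≠ 0 := han.continuousAt.eventually_ne hself
  have hF0 : ∀ᶠ ζ in 𝓝 a, F ζ ≠ 0 := hF.self_of_nhds.continuousAt.eventually_ne ha
  refine mono ((of_harmonicAt (han.harmonicAt_log_norm hself)).add (const (-log ‖F a‖))) ?_ ?_ ?_
  · filter_upwards [h0, hF0] with ζ h1 h2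
    have := log_le_log (norm_pos_iff.2 h1) (norm_inner_le_norm (𝕜 := ℂ) (F a) (F ζ))
    rw [log_mul hna.ne' (norm_pos_iff.2 h2).ne'] at this
    linarith
  · have : ‖inner ℂ (F a) (F a)‖ = ‖F a‖ * ‖F a‖ := by
      rw [inner_self_eq_norm_sq_to_K]; simp [sq]
    rw [this, log_mul hna.ne' hna.ne']; ring
  · filter_upwards [hF, hF0] with ζ hζ h0
    exact hζ.continuousAt.norm.log (norm_ne_zero_iff.2 h0)

/-- The point from which the squared norm is measured does not matter: the difference is
pluriharmonic. -/
theorem sub_norm_sub_sq {ε : ℝ} (h : SubmeanAt (fun ζ => g ζ - ε * ‖F ζ‖ ^ 2) a)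
    (hF : ∀ᶠ ζ in 𝓝 a, DifferentiableAt ℂ F ζ) (p : E) :
    SubmeanAt (fun ζ => g ζ - ε * ‖F ζ - p‖ ^ 2) a := by
  have h1 := (h.add (re_inner hF ((2 * ε : ℂ) • p))).add (const (-ε * ‖p‖ ^ 2))
  refine h1.congr (Eventually.of_forall fun ζ => ?_)
  have h2 : RCLike.re (inner ℂ (F ζ) p) = (inner ℂ p (F ζ)).re  :=
    inner_re_symm _ _
  have h3 : (inner ℂ ((2 * ε : ℂ) • p) (F ζ)).re = 2 * ε * (inner ℂ p (F ζ)).re := by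
    rw [inner_smul_left]
    simp
  simp only [h3, norm_sub_sq (𝕜 := ℂ) (F ζ) p, h2]
  ring

end SubmeanAt

theorem OpenPartialHomeomorph.eventually_continuousAt {X Y : Type*} [TopologicalSpace X]
    [TopologicalSpace Y] (φ : OpenPartialHomeomorph X Y) {x : X} (hx : x ∈ φ.source) :
    ∀ᶠ z in 𝓝 x, ContinuousAt φ z :=
  (φ.open_source.eventually_mem hx).mono fun _ hz => φ.continuousAt hz

/-! ### Pointwise plurisubharmonicity of continuous functions on the manifold -/

section

variable (n : ℕ) {M : Type*} [TopologicalSpace M] [ChartedSpace (EuclideanSpace ℂ (Fin n)) M]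

/-- `g` is continuous near `x` and satisfies the submean inequality at `x` along every holomorphic
disc through `x`. -/
def PshAt (g : M → ℝ) (x : M) : Prop :=
  (∀ᶠ z in 𝓝 x, ContinuousAt g z) ∧ ∀ (f : ℂ → M) (a : ℂ), f a = x →
    (∀ᶠ ζ in 𝓝 a, MDifferentiableAt 𝓘(ℂ, ℂ) 𝓘(ℂ, EuclideanSpace ℂ (Fin n)) f ζ) →
    SubmeanAt (fun ζ => g (f ζ)) a

variable {n}

namespace PshAt

variable {g g' : M → ℝ} {x : M}

theorem congr (h : PshAt n g x) (he : g =ᶠ[𝓝 x] g') : PshAt n g' x := by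
  refine ⟨?_, fun f a hfa hf => ?_⟩
  · filter_upwards [h.1, he.eventuallyEq_nhds] with z hz hz'
    exact hz.congr hz'
  · subst hfa
    exact (h.2 f a rfl hf).congr (hf.self_of_nhds.continuousAt.eventually he)

theorem add (h : PshAt n g x) (h' : PshAt n g' x) : PshAt n (fun z => g z + g' z) x :=
  ⟨by filter_upwards [h.1, h'.1] with z h1 h2 using h1.add h2,
    fun f a hfa hf => (h.2 f a hfa hf).add (h'.2 f a hfa hf)⟩

theorem const_mul (h : PshAt n g x) {c : ℝ} (hc : 0 ≤ c) : PshAt n (fun z => c * g z) x :=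
  ⟨by filter_upwards [h.1] with z h1 using h1.const_mul c,
    fun f a hfa hf => (h.2 f a hfa hf).const_mul hc⟩

theorem sup (h : PshAt n g x) (h' : PshAt n g' x) : PshAt n (fun z => max (g z) (g' z)) x :=
  ⟨by filter_upwards [h.1, h'.1] with z h1 h2 using h1.max h2,
    fun f a hfa hf => (h.2 f a hfa hf).sup (h'.2 f a hfa hf)⟩

theorem const (c : ℝ) : PshAt n (fun _ : M => c) x :=
  ⟨Eventually.of_forall fun _ => continuousAt_const, fun _ _ _ _ => SubmeanAt.const c⟩

variable {φ : OpenPartialHomeomorph M (EuclideanSpace ℂ (Fin n))}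

theorem eventually_differentiableAt_chart_comp (hφ : φ ∈ holoCharts n M) {f : ℂ → M} {a : ℂ}
    (ha : f a ∈ φ.source)
    (hf : ∀ᶠ ζ in 𝓝 a, MDifferentiableAt 𝓘(ℂ, ℂ) 𝓘(ℂ, EuclideanSpace ℂ (Fin n)) f ζ) :
    ∀ᶠ ζ in 𝓝 a, DifferentiableAt ℂ (fun ζ => φ (f ζ)) ζ := by
  have hs := hf.self_of_nhds.continuousAt.eventually (φ.open_source.mem_nhds ha)
  filter_upwards [hf, hs] with ζ h1 h2
  rw [← mdifferentiableAt_iff_differentiableAt]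
  exact MDifferentiableAt.comp ζ
    ((contMDiffAt_of_mem_maximalAtlas hφ h2).mdifferentiableAt (by simp)) h1

theorem chart_norm_sq (hφ : φ ∈ holoCharts n M) (hx : x ∈ φ.source) :
    PshAt n (fun z => ‖φ z‖ ^ 2) x := by
  refine ⟨(φ.eventually_continuousAt hx).mono fun z hz => hz.norm.pow 2, ?_⟩
  rintro f a rfl hf
  exact SubmeanAt.norm_sq (eventually_differentiableAt_chart_comp hφ hx hf)

theorem chart_log_norm_sub (hφ : φ ∈ holoCharts n M) (hx : x ∈ φ.source) {w : M}
    (hw : w ∈ φ.source) (hxw : x ≠ w) : PshAt n (fun z => log ‖φ z - φ w‖) x := by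
  have hne (z : M) (hz : z ∈ φ.source) (hzw : z ≠ w) : φ z - φ w ≠ 0 :=
    sub_ne_zero.2 fun h => hzw (φ.injOn hz hw h)
  refine ⟨?_, ?_⟩
  · have h0 : ∀ᶠ z in 𝓝 x, φ z - φ w ≠ 0 :=
      ((φ.continuousAt hx).sub continuousAt_const).eventually_ne (hne x hx hxw)
    filter_upwards [φ.eventually_continuousAt hx, h0] with z hz h0
    exact (hz.sub continuousAt_const).norm.log (norm_ne_zero_iff.2 h0)
  · rintro f a rfl hf
    exact SubmeanAt.log_norm ((eventually_differentiableAt_chart_comp hφ hx hf).mono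
      fun ζ hζ => hζ.sub_const _) (hne _ hx hxw)

theorem sub_chart_norm_sub_sq {ε : ℝ} (hφ : φ ∈ holoCharts n M) (hx : x ∈ φ.source)
    (h : PshAt n (fun z => g z - ε * ‖φ z‖ ^ 2) x) (p : EuclideanSpace ℂ (Fin n)) :
    PshAt n (fun z => g z - ε * ‖φ z - p‖ ^ 2) x := by
  refine ⟨?_, ?_⟩
  · filter_upwards [h.1, φ.eventually_continuousAt hx] with z hz hz'
    have : ContinuousAt g z := (hz.add ((hz'.norm.pow 2).const_mul ε)).congr
      (Eventually.of_forall fun y => by simp)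
    exact this.sub ((hz'.sub continuousAt_const).norm.pow 2 |>.const_mul ε)
  · rintro f a rfl hf
    exact (h.2 f a rfl hf).sub_norm_sub_sq (eventually_differentiableAt_chart_comp hφ hx hf) p

end PshAt

theorem IsPlurisubharmonicOn.pshAt {g : M → ℝ} {S : Set M} (hS : IsOpen S)
    (h : IsPlurisubharmonicOn n (fun z => (g z : EReal)) S) (hg : ContinuousOn g S) {x : M}
    (hx : x ∈ S) : PshAt n g x := by
  have hc (z : M) (hz : z ∈ S) : ContinuousAt g z := hg.continuousAt (hS.mem_nhds hz)
  refine ⟨(hS.eventually_mem hx).mono hc, ?_⟩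
  rintro f a rfl hf
  have hfS : ∀ᶠ ζ in 𝓝 a, f ζ ∈ S := hf.self_of_nhds.continuousAt.eventually (hS.mem_nhds hx)
  obtain ⟨V, hV, hVo, haV⟩ := _root_.eventually_nhds_iff.1 (hf.and hfS)
  have hcomp : ∀ ζ ∈ V, ContinuousAt (fun ζ => g (f ζ)) ζ := fun ζ hζ =>
    ContinuousAt.comp (hc _ (hV ζ hζ).2) (hV ζ hζ).1.continuousAt
  have hce : ∀ᶠ ζ in 𝓝 a, ContinuousAt (fun ζ => g (f ζ)) ζ :=
    (hVo.eventually_mem haV).mono hcomp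
  refine ⟨hce, ?_⟩
  obtain ⟨ρ, hρ, hsub⟩ := (h.comp_disc V f hVo
    (fun ζ hζ => (hV ζ hζ).1.mdifferentiableWithinAt) fun ζ hζ => (hV ζ hζ).2).submean a haV
  filter_upwards [Ioo_mem_nhdsGT hρ, eventually_continuousOn_sphere hce] with r hr hcr
  have := hsub r hr.1 hr.2
  rwa [circleMean_coe hcr, EReal.coe_le_coe_iff] at this

open Classical in
/-- A function that is real, continuous and plurisubharmonic off the point `w`, extended by `-∞`,
is plurisubharmonic as soon as it is upper semicontinuous at `w`. -/
theorem isPlurisubharmonicOn_of_pshAt [T1Space M] {g : M → ℝ} {w : M}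
    (hg : ∀ x, x ≠ w → PshAt n g x)
    (hw : UpperSemicontinuousAt (fun z => if z = w then (⊥ : EReal) else g z) w) :
    IsPlurisubharmonicOn n (fun z => if z = w then (⊥ : EReal) else g z) univ := by
  have heq (x : M) (hx : x ≠ w) :
      (fun z => (g z : EReal)) =ᶠ[𝓝 x] fun z => if z = w then (⊥ : EReal) else g z := by
    filter_upwards [isOpen_ne.eventually_mem hx] with z hz
    rw [if_neg hz]
  have husc (x : M) : UpperSemicontinuousAt (fun z => if z = w then (⊥ : EReal) else g z) x := by
    by_cases hx : x = w
    · exact hx ▸ hw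
    · exact ContinuousAt.upperSemicontinuousAt
        ((continuous_coe_real_ereal.continuousAt.comp (hg x hx).1.self_of_nhds).congr (heq x hx))
  have hlt (x : M) : (if x = w then (⊥ : EReal) else g x) < ⊤ := by
    split_ifs
    · exact bot_lt_top
    · exact EReal.coe_lt_top _
  refine ⟨fun x _ => (husc x).upperSemicontinuousWithinAt _, fun x _ => hlt x,
    fun V f hV hf _ => ⟨fun a ha => ?_, fun a _ => hlt _, fun a ha => ?_⟩⟩
  · refine UpperSemicontinuousAt.upperSemicontinuousWithinAt _ fun y hy => ?_
    exact ((hf a ha).mdifferentiableAt (hV.mem_nhds ha)).continuousAt.eventually (husc (f a) y hy)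
  · by_cases hx : f a = w
    · exact ⟨1, one_pos, fun r _ _ => by simp [hx]⟩
    have hfe : ∀ᶠ ζ in 𝓝 a,
        MDifferentiableAt 𝓘(ℂ, ℂ) 𝓘(ℂ, EuclideanSpace ℂ (Fin n)) f ζ :=
      (hV.eventually_mem ha).mono fun ζ hζ => (hf ζ hζ).mdifferentiableAt (hV.mem_nhds hζ)
    have hs := (hg _ hx).2 f a rfl hfe
    have hev := eventually_sphere_of_eventually_nhds
      (hfe.self_of_nhds.continuousAt.eventually (heq _ hx))
    obtain ⟨ρ, hρ, hr⟩ := mem_nhdsGT_iff_exists_Ioo_subset.1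
      (hs.2.and ((eventually_continuousOn_sphere hs.1).and hev))
    refine ⟨ρ, hρ, fun r h0 hrρ => ?_⟩
    obtain ⟨h1, h2, h3⟩ := hr ⟨h0, hrρ⟩
    rw [← circleMean_congr h3, circleMean_coe h2, if_neg hx]
    exact EReal.coe_le_coe_iff.2 h1

end

/-! ### The pole term and its gluing -/

section

variable {n : ℕ} {M : Type*} [TopologicalSpace M] [ChartedSpace (EuclideanSpace ℂ (Fin n)) M]
  {φ : OpenPartialHomeomorph M (EuclideanSpace ℂ (Fin n))}

theorem IsStrictlyPlurisubharmonic.pshAt {u : M → ℝ} (hu : Continuous u)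
    (h : IsStrictlyPlurisubharmonic n fun z => (u z : EReal)) (x : M) : PshAt n u x := by
  obtain ⟨φ, hφ, hx, ε, hε, hpsh⟩ := h x
  have h1 : PshAt n (fun z => u z - ε * ‖φ z‖ ^ 2) x :=
    IsPlurisubharmonicOn.pshAt φ.open_source hpsh
      (hu.continuousOn.sub (continuousOn_const.mul (φ.continuousOn.norm.pow 2))) hx
  exact (h1.add ((PshAt.chart_norm_sq hφ hx).const_mul hε.le)).congr
    (Eventually.of_forall fun z => by ring)

omit [ChartedSpace (EuclideanSpace ℂ (Fin n)) M] in
theorem logDist_eq_coe {z w : M} (hz : z ∈ φ.source) (hw : w ∈ φ.source) (hzw : z ≠ w) :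
    logDist φ z w = (log ‖φ z - φ w‖ : ℝ) := by
  have : 0 < ‖φ z - φ w‖ := norm_pos_iff.2 (sub_ne_zero.2 fun h => hzw (φ.injOn hz hw h))
  rw [logDist, ← ofReal_norm, ENNReal.log_ofReal_of_pos this]

omit [ChartedSpace (EuclideanSpace ℂ (Fin n)) M] in
-- The majorant tends to $-\infty$ at $w$, hence so does `G`.
theorem upperSemicontinuousAt_of_le_logDist {G : M → EReal} {w : M} (hw : w ∈ φ.source)
    {c : ℝ} (h : ∀ᶠ z in 𝓝 w, G z ≤ logDist φ z w + c) : UpperSemicontinuousAt G w := by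
  have hself : logDist φ w w = ⊥ := by simp [logDist]
  have hlog : Tendsto (fun z => logDist φ z w) (𝓝 w) (𝓝 ⊥) := by
    rw [← hself]
    exact ENNReal.continuous_log.continuousAt.comp
      ((φ.continuousAt hw).sub continuousAt_const).enorm
  have ht : Tendsto (fun z => logDist φ z w + (c : EReal)) (𝓝 w) (𝓝 ⊥) := by
    have := (EReal.continuousAt_add_bot_coe c).tendsto.comp
      (hlog.prodMk_nhds (tendsto_const_nhds (x := (c : EReal))))
    simpa [Function.comp_def] using this
  intro y hy
  filter_upwards [h, ht.eventually_lt_const (bot_le.trans_lt hy)] with z h1 h2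
  exact h1.trans_lt h2

/-- The local part of the competitor for the Green function with pole `w`, to be added to a
multiple of the strictly plurisubharmonic function. -/
noncomputable def poleTerm (φ : OpenPartialHomeomorph M (EuclideanSpace ℂ (Fin n)))
    (p : EuclideanSpace ℂ (Fin n)) (κ R : ℝ) (w z : M) : ℝ :=
  κ * (6 * R ^ 2 - ‖φ z - p‖ ^ 2) + log ‖φ z - φ w‖

open Classical in
/-- `poleTerm` near `p`, its positive part on a shell, and zero away from `p`. -/
noncomputable def gluedPoleTerm (φ : OpenPartialHomeomorph M (EuclideanSpace ℂ (Fin n)))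
    (p : EuclideanSpace ℂ (Fin n)) (κ R : ℝ) (w z : M) : ℝ :=
  if z ∈ φ.source ∧ ‖φ z - p‖ < 2 * R then poleTerm φ p κ R w z
  else if z ∈ φ.source ∧ ‖φ z - p‖ < 4 * R then max (poleTerm φ p κ R w z) 0
  else 0

variable {p : EuclideanSpace ℂ (Fin n)} {κ R : ℝ} {w z : M}

omit [ChartedSpace (EuclideanSpace ℂ (Fin n)) M] in
-- The factor 6 lies strictly between $2^2$ and $3^2$: the quadratic term is at least $\kappa R^2$
-- up to radius $2R$ and at most $-\kappa R^2$ from radius $3R$ on. Either bound dominates the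
-- logarithm, as $\|\varphi(z)-\varphi(w)\|$ is at least $R/2$ here and at most $5R$ in
-- `poleTerm_nonpos`.
theorem poleTerm_nonneg (hκ : 0 ≤ κ) (hR : 0 < R) (hκR : |log (R / 2)| ≤ κ * R ^ 2)
    (hw : ‖φ w - p‖ < R / 2) (h1 : R ≤ ‖φ z - p‖) (h2 : ‖φ z - p‖ ≤ 2 * R) :
    0 ≤ poleTerm φ p κ R w z := by
  have hn : R / 2 ≤ ‖φ z - φ w‖ := by
    have := norm_sub_le_norm_sub_add_norm_sub (φ z) (φ w) p
    linarith
  have hlog := log_le_log (by positivity) hn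
  have hsq : ‖φ z - p‖ ^ 2 ≤ 4 * R ^ 2 := by nlinarith [norm_nonneg (φ z - p)]
  have := mul_le_mul_of_nonneg_left
    (show R ^ 2 ≤ 6 * R ^ 2 - ‖φ z - p‖ ^ 2 by nlinarith) hκ
  have := neg_abs_le (log (R / 2))
  rw [poleTerm]
  linarith

omit [ChartedSpace (EuclideanSpace ℂ (Fin n)) M] in
theorem log_norm_chart_sub_le (hR : 0 < R) (hw : ‖φ w - p‖ < R / 2) (h : ‖φ z - p‖ ≤ 4 * R)
    (hz : z ∈ φ.source) (hws : w ∈ φ.source) (hzw : z ≠ w) :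
    log ‖φ z - φ w‖ ≤ |log (5 * R)| := by
  have hpos : 0 < ‖φ z - φ w‖ := norm_pos_iff.2 (sub_ne_zero.2 fun h => hzw (φ.injOn hz hws h))
  have := norm_sub_le_norm_sub_add_norm_sub (φ z) p (φ w)
  rw [norm_sub_rev p] at this
  exact (log_le_log hpos (by linarith)).trans (le_abs_self _)

omit [ChartedSpace (EuclideanSpace ℂ (Fin n)) M] in
theorem poleTerm_nonpos (hκ : 0 ≤ κ) (hR : 0 < R) (hκR : |log (5 * R)| ≤ κ * R ^ 2)
    (hw : ‖φ w - p‖ < R / 2) (h1 : 3 * R ≤ ‖φ z - p‖) (h2 : ‖φ z - p‖ ≤ 4 * R)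
    (hz : z ∈ φ.source) (hws : w ∈ φ.source) (hzw : z ≠ w) :
    poleTerm φ p κ R w z ≤ 0 := by
  have hlog := log_norm_chart_sub_le hR hw h2 hz hws hzw
  have hsq : 9 * R ^ 2 ≤ ‖φ z - p‖ ^ 2 := by nlinarith
  have := mul_le_mul_of_nonneg_left
    (show 6 * R ^ 2 - ‖φ z - p‖ ^ 2 ≤ -R ^ 2 by nlinarith) hκ
  rw [poleTerm]
  linarith

omit [ChartedSpace (EuclideanSpace ℂ (Fin n)) M] in
theorem poleTerm_le (hκ : 0 ≤ κ) : poleTerm φ p κ R w z ≤ log ‖φ z - φ w‖ + 6 * κ * R ^ 2 := by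
  have := mul_nonneg hκ (sq_nonneg ‖φ z - p‖)
  rw [poleTerm]
  linarith

omit [ChartedSpace (EuclideanSpace ℂ (Fin n)) M] in
theorem gluedPoleTerm_le (hκ : 0 ≤ κ) (hR : 0 < R) (hw : ‖φ w - p‖ < R / 2) (hws : w ∈ φ.source)
    (hzw : z ≠ w) : gluedPoleTerm φ p κ R w z ≤ |log (5 * R)| + 6 * κ * R ^ 2 := by
  have h0 : 0 ≤ |log (5 * R)| + 6 * κ * R ^ 2 := by positivity
  rw [gluedPoleTerm]
  split_ifs with h1 h2
  · have := log_norm_chart_sub_le hR hw (by linarith) h1.1 hws hzw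
    linarith [poleTerm_le hκ (φ := φ) (p := p) (R := R) (w := w) (z := z)]
  · have := log_norm_chart_sub_le hR hw h2.2.le h2.1 hws hzw
    exact max_le (by linarith [poleTerm_le hκ (φ := φ) (p := p) (R := R) (w := w) (z := z)]) h0
  · exact h0

theorem pshAt_add_gluedPoleTerm [T2Space M] [IsManifold 𝓘(ℂ, EuclideanSpace ℂ (Fin n)) ω M]
    {u : M → ℝ} {K ε : ℝ} (hφ : φ ∈ holoCharts n M) (hu : ∀ x, PshAt n u x)
    (huε : ∀ x ∈ φ.source, PshAt n (fun z => u z - ε * ‖φ z‖ ^ 2) x)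
    (hK : 0 ≤ K) (hκ : 0 ≤ K * ε) (hR : 0 < R) (hp : closedBall p (3 * R) ⊆ φ.target)
    (hκR : |log (R / 2)| ≤ K * ε * R ^ 2) (hκR' : |log (5 * R)| ≤ K * ε * R ^ 2)
    (hw : ‖φ w - p‖ < R / 2) (hws : w ∈ φ.source) {x : M} (hx : x ≠ w) :
    PshAt n (fun z => K * u z + gluedPoleTerm φ p (K * ε) R w z) x := by
  have hpole (hxs : x ∈ φ.source) :
      PshAt n (fun z => K * u z + poleTerm φ p (K * ε) R w z) x := by
    refine ((((PshAt.sub_chart_norm_sub_sq hφ hxs (huε x hxs) p).const_mul hK).add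
      (PshAt.chart_log_norm_sub hφ hxs hws hx)).add (.const (K * ε * (6 * R ^ 2)))).congr
      (Eventually.of_forall fun z => ?_)
    simp only [poleTerm]
    ring
  have hnorm (hxs : x ∈ φ.source) : ContinuousAt (fun z => ‖φ z - p‖) x :=
    ((φ.continuousAt hxs).sub continuousAt_const).norm
  have hKu : PshAt n (fun z => K * u z) x := (hu x).const_mul hK
  by_cases hx3 : x ∈ φ.source ∧ ‖φ x - p‖ ≤ 3 * R
  · obtain ⟨hxs, hx3⟩ := hx3
    have hs := φ.open_source.eventually_mem hxs
    rcases le_or_gt (2 * R) ‖φ x - p‖ with hx2 | hx2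
    -- Near radii in $[2R,3R]$ the glued function is the maximum of the two candidates: below $2R$
    -- the pole term is nonnegative, so the maximum is already the first one.
    · refine ((hpole hxs).sup hKu).congr ?_
      filter_upwards [hs, (hnorm hxs).eventually_lt_const (show ‖φ x - p‖ < 4 * R by linarith),
        (hnorm hxs).eventually_const_lt (show R < ‖φ x - p‖ by linarith)] with z hz hz4 hz1
      have hmax : max (K * u z + poleTerm φ p (K * ε) R w z) (K * u z)
          = K * u z + max (poleTerm φ p (K * ε) R w z) 0 := by
        rw [← max_add_add_left, add_zero]
      rw [hmax, gluedPoleTerm]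
      split_ifs with h1 h2
      · rw [max_eq_left (poleTerm_nonneg hκ hR hκR hw hz1.le h1.2.le)]
      · rfl
      · exact absurd ⟨hz, hz4⟩ h2
    · refine (hpole hxs).congr ?_
      filter_upwards [hs, (hnorm hxs).eventually_lt_const hx2] with z hz hz2
      rw [gluedPoleTerm, if_pos ⟨hz, hz2⟩]
  -- The closed coordinate ball is compact, hence closed in the Hausdorff space $M$. Its complement
  -- is thus a neighbourhood of `x`, and there the glued term vanishes.
  · have hclosed : IsClosed (φ.symm '' closedBall p (3 * R)) :=
      ((isCompact_closedBall p (3 * R)).image_of_continuousOn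
        (φ.continuousOn_symm.mono hp)).isClosed
    have hmem (z : M) : z ∈ φ.symm '' closedBall p (3 * R) ↔ z ∈ φ.source ∧ ‖φ z - p‖ ≤ 3 * R := by
      constructor
      · rintro ⟨y, hy, rfl⟩
        refine ⟨φ.map_target (hp hy), ?_⟩
        rw [φ.right_inv (hp hy)]
        exact mem_closedBall_iff_norm.1 hy
      · rintro ⟨hz, hz3⟩
        exact ⟨φ z, mem_closedBall_iff_norm.2 hz3, φ.left_inv hz⟩
    refine hKu.congr ?_
    filter_upwards [hclosed.isOpen_compl.eventually_mem (mt (hmem x).1 hx3),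
      isOpen_ne.eventually_mem hx] with z hz hzw
    have hz' := mt (hmem z).2 hz
    rw [gluedPoleTerm]
    split_ifs with h1 h2
    · exact absurd ⟨h1.1, by linarith [h1.2]⟩ hz'
    · have h3 : 3 * R ≤ ‖φ z - p‖ := by
        by_contra! h
        exact hz' ⟨h2.1, h.le⟩
      rw [max_eq_right (poleTerm_nonpos hκ hR hκR' hw h3 h2.2.le h2.1 hws hzw), add_zero]
    · rw [add_zero]

end

theorem mainTheorem3 (n : ℕ) (M : Type*) [TopologicalSpace M] [T2Space M]
    [ChartedSpace (EuclideanSpace ℂ (Fin n)) M]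
    [IsManifold 𝓘(ℂ, EuclideanSpace ℂ (Fin n)) ω M]
    (h : ∃ u : M → ℝ, Continuous u ∧ (∃ C : ℝ, ∀ z, |u z| ≤ C) ∧
      IsStrictlyPlurisubharmonic n (fun z => (u z : EReal))) :
    IsLocallyUniformlyPluriGreenian n M := by
  classical
  obtain ⟨u, hu, ⟨C, hC⟩, hspsh⟩ := h
  intro w₀
  obtain ⟨φ, hφ, hw₀, ε, hε, hpsh⟩ := hspsh w₀
  have huε (x : M) (hx : x ∈ φ.source) : PshAt n (fun z => u z - ε * ‖φ z‖ ^ 2) x :=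
    IsPlurisubharmonicOn.pshAt φ.open_source hpsh
      (hu.continuousOn.sub (continuousOn_const.mul (φ.continuousOn.norm.pow 2))) hx
  set p := φ w₀
  obtain ⟨R, hR, hball⟩ : ∃ R > 0, closedBall p (3 * R) ⊆ φ.target := by
    obtain ⟨r, hr, hsub⟩ := nhds_basis_closedBall.mem_iff.1
      (φ.open_target.mem_nhds (φ.map_source hw₀))
    exact ⟨r / 3, by positivity, by rwa [mul_div_cancel₀ r three_ne_zero]⟩
  -- `K` depends on `R` and `ε` but not on the pole, which makes the final constant uniform in `w`.
  obtain ⟨K, hK, hK1, hK2⟩ : ∃ K ≥ 0, |log (R / 2)| ≤ K * ε * R ^ 2 ∧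
      |log (5 * R)| ≤ K * ε * R ^ 2 := by
    have he : (|log (R / 2)| + |log (5 * R)|) / (ε * R ^ 2) * ε * R ^ 2
        = |log (R / 2)| + |log (5 * R)| := by field_simp
    refine ⟨(|log (R / 2)| + |log (5 * R)|) / (ε * R ^ 2), by positivity, ?_, ?_⟩ <;> rw [he]
    · exact le_add_of_nonneg_right (abs_nonneg _)
    · exact le_add_of_nonneg_left (abs_nonneg _)
  -- `B` exceeds by 1 an upper bound for `K * u` plus the glued term, so subtracting it gives a
  -- strictly negative function.
  have hκ : 0 ≤ K * ε := by positivity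
  set B := |log (5 * R)| + 6 * (K * ε) * R ^ 2 + K * C + 1 with hB
  have hKu (z : M) : -(K * C) ≤ K * u z ∧ K * u z ≤ K * C := by
    obtain ⟨h1, h2⟩ := abs_le.1 (hC z)
    constructor <;> nlinarith
  set U := φ.source ∩ φ ⁻¹' ball p R
  have hUo : IsOpen U := φ.isOpen_inter_preimage isOpen_ball
  have hφU : φ.restr U ∈ holoCharts n M := restr_mem_maximalAtlas _ hφ hUo
  have hUs : (φ.restr U).source = U := by
    rw [φ.restr_source, hUo.interior_eq]
    exact inter_eq_right.2 inter_subset_left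
  have hdist (z w : M) : logDist (φ.restr U) z w = logDist φ z w := rfl
  -- On `U` the glued term is the pole term, whose quadratic part is nonnegative. The competitor is
  -- therefore at least $\log\|z-w\|-KC-B$; the extra $-1$ yields strictness.
  refine ⟨φ.restr U, hφU, hUs.ge ⟨hw₀, mem_ball_self hR⟩, φ.source ∩ φ ⁻¹' ball p (R / 2),
    φ.isOpen_inter_preimage isOpen_ball, ⟨hw₀, mem_ball_self (by positivity)⟩,
    fun z hz => hUs.ge ⟨hz.1, ball_subset_ball (half_le_self hR.le) hz.2⟩, -(K * C) - B - 1, ?_⟩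
  rintro w ⟨hws, hwR⟩ z hz hzw
  have hwR' : ‖φ w - p‖ < R / 2 := mem_ball_iff_norm.1 hwR
  have hwU : w ∈ U := ⟨hws, ball_subset_ball (half_le_self hR.le) hwR⟩
  set g : M → ℝ := fun z => K * u z + gluedPoleTerm φ p (K * ε) R w z + -B with hg
  set G : M → EReal := fun z => if z = w then ⊥ else (g z : EReal) with hG
  have hgU (z : M) (hz : z ∈ U) :
      g z = K * u z + poleTerm φ p (K * ε) R w z + -B := by
    have : ‖φ z - p‖ < 2 * R := by linarith [mem_ball_iff_norm.1 hz.2]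
    simp only [hg, gluedPoleTerm, if_pos (show _ ∧ _ from ⟨hz.1, this⟩)]
  have hpole (z : M) (hz : z ∈ U) :
      G z ≤ logDist φ z w + ((6 * (K * ε) * R ^ 2 + K * C - B : ℝ) : EReal) := by
    by_cases hzw : z = w
    · simp [hG, hzw]
    · simp only [hG, if_neg hzw]
      rw [logDist_eq_coe hz.1 hws hzw, hgU z hz, ← EReal.coe_add, EReal.coe_le_coe_iff]
      linarith [hKu z, poleTerm_le hκ (φ := φ) (p := p) (R := R) (w := w) (z := z)]
  have hGpsh : IsPlurisubharmonicOn n G univ := by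
    refine isPlurisubharmonicOn_of_pshAt (fun x hx => ?_)
      (upperSemicontinuousAt_of_le_logDist hws ((hUo.eventually_mem hwU).mono hpole))
    exact (pshAt_add_gluedPoleTerm hφ (hspsh.pshAt hu) huε hK hκ hR hball hK1 hK2 hwR' hws hx).add
      (.const _)
  have hGneg (x : M) : G x < 0 := by
    by_cases hx : x = w
    · simp [hG, hx]
    · simp only [hG, if_neg hx]
      have := gluedPoleTerm_le hκ hR hwR' hws hx
      exact_mod_cast (by simp only [hg]; linarith [hKu x] : g x < 0)
  have hGpole : HasLogPole n G w :=
    ⟨φ.restr U, hφU, hUs.ge hwU, _, fun x hx => hpole x (hUs.le hx)⟩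
  refine lt_of_lt_of_le ?_
    (le_iSup₂ (f := fun (v : M → EReal) _ => v z) G ⟨hGpsh, hGneg, hGpole⟩)
  rw [hUs] at hz
  have hsq : ‖φ z - p‖ ^ 2 ≤ R ^ 2 :=
    pow_le_pow_left₀ (norm_nonneg _) (mem_ball_iff_norm.1 hz.2).le 2
  have : 0 ≤ K * ε * (6 * R ^ 2 - ‖φ z - p‖ ^ 2) := mul_nonneg hκ (by nlinarith)
  simp only [hG, if_neg hzw]
  rw [hdist, logDist_eq_coe hz.1 hws hzw, hgU z hz, ← EReal.coe_add, EReal.coe_lt_coe_iff, poleTerm]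
  linarith [hKu z]
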